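/- Let $k\ge 1$ be the number of items, let $n$ be the number of applicants, and let $\mathbf F=(F_1,\dots,F_n)$ be probability distributions on $[0,\infty)$. Applicant $i$ has a value $V_i$ with distribution $F_i$, the values are independent, and the applicants arrive in a uniformly random order, independent of the values. The static threshold policy with threshold $t\ge 0$ and tie-break probability $p\in[0,1]$ does the following as long as items remain: it accepts an arriving applicant $i$ if $V_i>t$, accepts with probability $p$ (independently of all other randomness) if $V_i=t$, and rejects if $V_i<t$. Each accepted applicant uses one item. The demand $D$ is the number of applicants $i$ that have $V_i>t$, or have $V_i=t$ and win their tie-breaking coin toss (one independent toss, won with probability $p$, for each applicant). The expected utilization is $\mathbb E[\min(1,D/k)]$, and the performance $\mathcal{ST}$ of the policy is the expected sum of the values of the accepted applicants. The prophet's value $\mathcal{PHT}$ is the expected sum of the $k$ largest values (of all values if $n<k$), and the ex-ante value (LP relaxation) is $$\mathcal{LP}=\sup\Big\{\sum_{i=1}^n\int_{1-x_i}^1 F_i^{-1}(z)\,dz:\ \sum_{i=1}^n x_i\le k,\ 0\le x_i\le 1\ \text{for all } i\Big\},$$ where $F_i^{-1}$ is the quantile function of $F_i$. These quantities take values in $[0,\infty]$.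 Put $\gamma_k=1-e^{-k}k^k/k!$. **Theorem.** If the expected utilization of the policy $(t,p)$ equals $\gamma_k$, then its performance is at least $\gamma_k$ times the prophet's value, $\mathcal{ST}\ge\gamma_k\,\mathcal{PHT}$. In fact $\mathcal{ST}\ge\gamma_k\,\mathcal{LP}$, where $\mathcal{LP}\ge\mathcal{PHT}$. -/

import Mathlib

open MeasureTheory
open scoped NNReal ENNReal

namespace ProphetSecretary

/-- The constant `γ_k = 1 - e^{-k} k^k / k!`. -/
noncomputable def gam (k : ℕ) : ℝ :=
  1 - Real.exp (-(k : ℝ)) * (k : ℝ) ^ k / (k.factorial : ℝ)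

/-- The utilization `min (1, d / k)` when the realized demand is `d`. -/
noncomputable def UT (k d : ℕ) : ℝ := min 1 ((d : ℝ) / (k : ℝ))

/-- The values of the `n` applicants, each one together with the outcome of the applicant's
tie-breaking coin. -/
abbrev Outcome (n : ℕ) : Type := Fin n → ℝ≥0 × Bool

/-- The joint law of values and coins: applicant `i` has a value drawn from `F i` and a coin that
is `true` with probability `p`, and all of these are independent. -/
noncomputable def law {n : ℕ} (F : Fin n → Measure ℝ≥0) (p : unitInterval) :
    Measure (Outcome n) :=
  Measure.pi fun i => (F i).prod (ProbabilityTheory.bernoulliMeasure true false p)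

/-- The applicants whom the threshold `t` accepts as long as items remain: those whose value
exceeds `t`, and those whose value is exactly `t` and whose coin shows `true`. -/
noncomputable def eligible {n : ℕ} (t : ℝ≥0) (ω : Outcome n) : Finset (Fin n) :=
  Finset.univ.filter fun i => t < (ω i).1 ∨ ((ω i).1 = t ∧ (ω i).2 = true)

/-- The demand at threshold `t`. -/
noncomputable def demand {n : ℕ} (t : ℝ≥0) (ω : Outcome n) : ℕ := (eligible t ω).card

/-- The applicants accepted when applicant `i` arrives at position `σ i` and items are handed out
first come, first served: an eligible applicant is accepted if and only if one of the `k` items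
remains, that is, fewer than `k` eligible applicants arrived before. -/
noncomputable def accepted {n : ℕ} (k : ℕ) (t : ℝ≥0) (ω : Outcome n)
    (σ : Equiv.Perm (Fin n)) : Finset (Fin n) :=
  (eligible t ω).filter fun i => ((eligible t ω).filter fun j => σ j < σ i).card < k

/-- The expected utilization of the threshold `t` with tie-break probability `p`. -/
noncomputable def expectedUtilization {n : ℕ} (k : ℕ) (F : Fin n → Measure ℝ≥0) (t : ℝ≥0)
    (p : unitInterval) : ℝ :=
  ∫ ω, UT k (demand t ω) ∂(law F p)

/-- The performance of the threshold `t` with tie-break probability `p`: the expected sum of the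
values of the accepted applicants, over values, coins and a uniformly random arrival order. It may
be infinite. -/
noncomputable def performance {n : ℕ} (k : ℕ) (F : Fin n → Measure ℝ≥0) (t : ℝ≥0)
    (p : unitInterval) : ℝ≥0∞ :=
  ∫⁻ ω, (∑ σ : Equiv.Perm (Fin n), ∑ i ∈ accepted k t ω σ, ((ω i).1 : ℝ≥0∞)) /
    (Fintype.card (Equiv.Perm (Fin n)) : ℝ≥0∞) ∂(law F p)

/-- The sum of the `k` largest of the values `v i` (of all of them, if there are fewer than `k`):
the largest total value of a set of at most `k` applicants. -/
noncomputable def topSum {n : ℕ} (k : ℕ) (v : Fin n → ℝ≥0) : ℝ≥0 :=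
  (Finset.univ.filter fun S : Finset (Fin n) => S.card ≤ k).sup fun S => ∑ i ∈ S, v i

/-- The prophet's value: the expected sum of the `k` largest values. It may be infinite. -/
noncomputable def prophetValue {n : ℕ} (k : ℕ) (F : Fin n → Measure ℝ≥0) : ℝ≥0∞ :=
  ∫⁻ v, (topSum k v : ℝ≥0∞) ∂(Measure.pi F)

/-- The quantile function (generalized inverse of the distribution function) of `ν`, which is
meaningful for `0 < z < 1`. -/
noncomputable def quantile (ν : Measure ℝ≥0) (z : ℝ) : ℝ≥0 :=
  sInf {x : ℝ≥0 | z ≤ ν.real (Set.Iic x)}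

/-- The ex-ante value (LP relaxation): applicant `i` is accepted in the top `x i` quantiles of
the distribution `F i`, and at most `k` applicants are accepted in expectation. It may be
infinite. -/
noncomputable def exAnteValue {n : ℕ} (k : ℕ) (F : Fin n → Measure ℝ≥0) : ℝ≥0∞ :=
  ⨆ x ∈ {x : Fin n → ℝ | (∀ i, 0 ≤ x i ∧ x i ≤ 1) ∧ ∑ i, x i ≤ (k : ℝ)},
    ∑ i, ∫⁻ z in Set.Ioo (1 - x i) 1, (quantile (F i) z : ℝ≥0∞)

end ProphetSecretary

/-! Split the value of an accepted applicant into the threshold `t` and the excess over `t`. The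
threshold part earns `t * E[min(D, k)] = gam k * k * t`. In a random order, an eligible applicant
with `d` eligible rivals is accepted with probability `acceptProb k d = min(1, k/(d+1))`,
independently of the own excess. The rivals number at most `D`, so it suffices that `E[acceptProb k
D] ≥ gam k`. Then the performance is at least `gam k * (k t + ∑ E[(V_i - t)^+])`, and the bracket
bounds the LP by weak duality (`gam_mul_le_performance`, `exAnteValue_le`).

The core is a comparison of `D` with a Poisson variable `N` of mean `k`, for which both `E[min(1,
N/k)]` and `E[acceptProb k N]` equal `gam k`. As a sum of independent Bernoulli variables, `D` is
ultra log-concave, so its likelihood ratio to `N` is unimodal. Since `E[min(D, k)] = E[min(N, k)]`,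
the distribution function of `D` dominates that of `N` from `k - 1` on. As `acceptProb k` is
constant below `k` and antitone, summation by parts finishes the comparison
(`gam_le_sum_acceptProb`). -/

namespace ProphetSecretary

/-! ### Ultra log-concave sequences. -/

/-- Log-concavity in exchange form, which excludes internal zeros of nonnegative sequences. -/
def ExchangeLogConcave (e : ℕ → ℝ) : Prop :=
  ∀ i j, i ≤ j → e i * e (j + 2) ≤ e (i + 1) * e (j + 1)

/-- Ultra log-concavity (log-concavity of `j! a j`) is preserved by convolution with a Bernoulli
distribution. -/
theorem ExchangeLogConcave.bernoulli_step {e c : ℕ → ℝ} {q : ℝ} (he : ExchangeLogConcave e)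
    (h0 : ∀ j, 0 ≤ e j) (hq0 : 0 ≤ q) (hq1 : q ≤ 1) (hc0 : c 0 = (1 - q) * e 0)
    (hc : ∀ j, c (j + 1) = (1 - q) * e (j + 1) + q * ((j + 1 : ℝ) * e j)) :
    ExchangeLogConcave c := by
  have hr : 0 ≤ 1 - q := by linarith
  have adj : ∀ i j, i ≤ j → e i * e (j + 1) ≤ e (i + 1) * e j := by
    intro i j hij
    rcases hij.eq_or_lt with rfl | hlt
    · rw [mul_comm]
    · obtain ⟨m, rfl⟩ : ∃ m, j = m + 1 := ⟨j - 1, by omega⟩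
      exact he i m (by omega)
  intro i j hij
  rw [hc i, hc j, hc (j + 1)]
  push_cast
  -- The difference of the two sides is grouped by the monomials `(1-q)^2`, `q(1-q)`, `q^2`. In the
  -- last group the factorial weights leave the surplus `(i+1)(j+1) - i(j+2) = j - i + 1 ≥ 0`.
  have h1 := mul_nonneg (mul_nonneg hr hr) (sub_nonneg.2 (he i j hij))
  have h2 := mul_nonneg (mul_nonneg (mul_nonneg hq0 hr) (by positivity : (0 : ℝ) ≤ j + 1))
    (sub_nonneg.2 (adj i j hij))
  rcases i with _ | m
  · rw [hc0]
    have h3 := mul_nonneg (mul_nonneg hq0 hq0) (mul_nonneg (by positivity : (0 : ℝ) ≤ j + 1)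
      (mul_nonneg (h0 0) (h0 j)))
    push_cast
    simp only [zero_add] at h1 h2 ⊢
    linarith
  · rw [hc m]
    have h3 := mul_nonneg (mul_nonneg (mul_nonneg hq0 hr) (by positivity : (0 : ℝ) ≤ m + 1))
      (sub_nonneg.2 (he m j (by omega)))
    have h4 := mul_nonneg (mul_nonneg (mul_nonneg hq0 hq0)
      (by positivity : (0 : ℝ) ≤ (m + 1) * (j + 2))) (sub_nonneg.2 (adj m j (by omega)))
    have hmj : (0 : ℝ) ≤ j - m := by
      have : ((m + 1 : ℕ) : ℝ) ≤ j := by exact_mod_cast hij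
      push_cast at this; linarith
    have h5 := mul_nonneg (mul_nonneg (mul_nonneg hq0 hq0) hmj) (mul_nonneg (h0 (m + 1)) (h0 j))
    push_cast
    nlinarith [h1, h2, h3, h4, h5]

/-- A nonnegative log-concave sequence is unimodal. -/
theorem ExchangeLogConcave.min_le {e : ℕ → ℝ} (he : ExchangeLogConcave e) (h0 : ∀ j, 0 ≤ e j)
    {i j l : ℕ} (hij : i ≤ j) (hjl : j ≤ l) : min (e i) (e l) ≤ e j := by
  by_contra! hlt
  obtain ⟨hi, hl⟩ := lt_min_iff.1 hlt
  obtain ⟨m, him, hmj, hdesc⟩ : ∃ m, i ≤ m ∧ m < j ∧ e (m + 1) < e m := by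
    by_contra! hno
    have : ∀ d, i + d ≤ j → e i ≤ e (i + d) := by
      intro d
      induction d with
      | zero => simp
      | succ d ih =>
        intro hd
        exact (ih (by omega)).trans (hno (i + d) (by omega) (by omega))
    have := this (j - i) (by omega)
    rw [Nat.add_sub_cancel' hij] at this
    linarith
  -- A strict descent at `m` forces descent from then on: the exchange inequality compares the later
  -- ratios with the one at `m`, and `e m > 0` can be cancelled.
  have anti : ∀ d, e (j + d) ≤ e j := by
    intro d
    induction d with
    | zero => simp
    | succ d ih =>
      obtain ⟨r, hr⟩ : ∃ r, j + d = r + 1 := ⟨j + d - 1, by omega⟩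
      refine le_trans ?_ ih
      rw [← add_assoc, hr]
      have h1 := he m r (by omega)
      have h2 : e (m + 1) * e (r + 1) ≤ e m * e (r + 1) :=
        mul_le_mul_of_nonneg_right hdesc.le (h0 _)
      exact le_of_mul_le_mul_left (h1.trans h2) ((h0 _).trans_lt hdesc)
  have := anti (l - j)
  rw [Nat.add_sub_cancel' hjl] at this
  linarith

/-! ### Comparison with the Poisson distribution. -/

/-- The probability that a Poisson random variable with mean `k` equals `j`. -/
noncomputable def poissonWeight (k j : ℕ) : ℝ :=
  Real.exp (-(k : ℝ)) * (k : ℝ) ^ j / (j.factorial : ℝ)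

/-- The probability that an eligible applicant is accepted when there are `d` other ones. -/
noncomputable def acceptProb (k d : ℕ) : ℝ := min 1 ((k : ℝ) / ((d : ℝ) + 1))

theorem hasSum_poissonWeight (k : ℕ) : HasSum (poissonWeight k) 1 := by
  have h := (NormedSpace.expSeries_div_hasSum_exp (k : ℝ)).mul_left (Real.exp (-(k : ℝ)))
  rw [← Real.exp_eq_exp_ℝ, ← Real.exp_add, neg_add_cancel, Real.exp_zero] at h
  rw [show poissonWeight k = fun j => Real.exp (-(k : ℝ)) * ((k : ℝ) ^ j / j.factorial) from
    funext fun j => mul_div_assoc _ _ _]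
  exact h

theorem mul_poissonWeight (k j : ℕ) :
    (k : ℝ) * poissonWeight k j = (j + 1) * poissonWeight k (j + 1) := by
  unfold poissonWeight
  rw [Nat.factorial_succ, pow_succ]
  push_cast
  field_simp

theorem gam_eq (k : ℕ) : gam k = 1 - poissonWeight k k := rfl

/-- At `m = k` this gives `E[(k - N)^+] = k * P(N = k)`, so Poisson demand has expected utilization
`gam k`. -/
theorem sum_mul_poissonWeight (k m : ℕ) :
    ∑ j ∈ Finset.range m, ((k : ℝ) - j) * poissonWeight k j = m * poissonWeight k m := by
  induction m with
  | zero => simp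
  | succ m ih =>
    rw [Finset.sum_range_succ, ih]
    have := mul_poissonWeight k m
    push_cast
    linarith

theorem acceptProb_nonneg (k d : ℕ) : 0 ≤ acceptProb k d := by
  unfold acceptProb; positivity

theorem acceptProb_antitone (k : ℕ) : Antitone (acceptProb k) := by
  intro a b hab
  unfold acceptProb
  have : (a : ℝ) ≤ b := by exact_mod_cast hab
  gcongr

theorem acceptProb_of_lt {k d : ℕ} (h : d < k) : acceptProb k d = 1 := by
  unfold acceptProb
  have : ((d + 1 : ℕ) : ℝ) ≤ k := by exact_mod_cast h
  push_cast at this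
  exact min_eq_left ((one_le_div (by positivity)).2 this)

theorem acceptProb_mul_poissonWeight {k d : ℕ} (h : k ≤ d) :
    acceptProb k d * poissonWeight k d = poissonWeight k (d + 1) := by
  unfold acceptProb
  have hk : (k : ℝ) ≤ d := by exact_mod_cast h
  have hd : (0 : ℝ) < d + 1 := by positivity
  rw [min_eq_right ((div_le_one hd).2 (by linarith)), div_mul_eq_mul_div, mul_poissonWeight]
  field_simp

/-- Terms below `k` are unchanged and terms from `k` on are shifted by one index, so exactly the
mass at `k` is lost. -/
theorem hasSum_acceptProb_mul_poissonWeight (k : ℕ) :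
    HasSum (fun d => acceptProb k d * poissonWeight k d) (gam k) := by
  rw [← hasSum_nat_add_iff' k]
  have h1 := (hasSum_nat_add_iff' (k + 1)).2 (hasSum_poissonWeight k)
  convert h1 using 1
  · funext d
    rw [acceptProb_mul_poissonWeight (by omega)]
    congr 1
  · rw [Finset.sum_range_succ, gam_eq, Finset.sum_congr rfl fun d hd => by
      rw [acceptProb_of_lt (Finset.mem_range.1 hd), one_mul]]
    ring

/-- Expresses `E[(k - D)^+]` as a sum of values of the distribution function. -/
theorem sum_range_sum_range_succ (f : ℕ → ℝ) (k : ℕ) :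
    ∑ d ∈ Finset.range k, ∑ j ∈ Finset.range (d + 1), f j =
      ∑ j ∈ Finset.range k, ((k : ℝ) - j) * f j := by
  induction k with
  | zero => simp
  | succ k ih =>
    rw [Finset.sum_range_succ, ih, Finset.sum_range_succ, Finset.sum_range_succ, ← add_assoc,
      ← Finset.sum_add_distrib]
    push_cast
    congr 1
    · exact Finset.sum_congr rfl fun j _ => by ring
    · ring

/-- The distribution functions of an ultra log-concave distribution and of a Poisson
distribution cross at most once. If the expectations of `min (·, k)` agree, then they cross
before `k`. -/
theorem sum_poissonWeight_le_of_exchangeLogConcave {k : ℕ} (hk : 1 ≤ k) {a : ℕ → ℝ}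
    (h0 : ∀ j, 0 ≤ a j) (ha : HasSum a 1)
    (hlc : ExchangeLogConcave fun j => (j.factorial : ℝ) * a j)
    (hmean : ∑ j ∈ Finset.range k, ((k : ℝ) - j) * a j =
      ∑ j ∈ Finset.range k, ((k : ℝ) - j) * poissonWeight k j) {d : ℕ} (hd : k ≤ d + 1) :
    ∑ j ∈ Finset.range (d + 1), poissonWeight k j ≤ ∑ j ∈ Finset.range (d + 1), a j := by
  have hk0 : (0 : ℝ) < k := by exact_mod_cast hk
  set C := Real.exp (-(k : ℝ)) with hC
  -- Up to the factor `C`, `f` is the likelihood ratio to the Poisson weights, so `f j - C` has the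
  -- sign of `δ j`.
  set f : ℕ → ℝ := fun j => (j.factorial : ℝ) * a j / (k : ℝ) ^ j with hf
  have hf0 : ∀ j, 0 ≤ f j := fun j => by have := h0 j; positivity
  have hflc : ExchangeLogConcave f := by
    intro i j hij
    have := hlc i j hij
    simp only [hf]
    rw [div_mul_div_comm, div_mul_div_comm, ← pow_add, ← pow_add,
      show i + (j + 2) = i + 1 + (j + 1) by ring]
    gcongr
  set δ : ℕ → ℝ := fun j => a j - poissonWeight k j with hδ
  have hδf : ∀ j, δ j = (f j - C) * ((k : ℝ) ^ j / j.factorial) := by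
    intro j
    simp only [hδ, hf, poissonWeight, ← hC]
    field_simp
  have hw : ∀ j : ℕ, (0 : ℝ) < (k : ℝ) ^ j / j.factorial := fun j => by positivity
  have hpos : ∀ j, C ≤ f j → 0 ≤ δ j := fun j h => by
    rw [hδf]; exact mul_nonneg (by linarith) (hw j).le
  have hneg : ∀ j, f j ≤ C → δ j ≤ 0 := fun j h => by
    rw [hδf]; exact mul_nonpos_of_nonpos_of_nonneg (by linarith) (hw j).le
  have hneg' : ∀ j, f j < C → δ j < 0 := fun j h => by
    rw [hδf]; exact mul_neg_of_neg_of_pos (by linarith) (hw j)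
  set G : ℕ → ℝ := fun d => ∑ j ∈ Finset.range (d + 1), δ j with hG
  suffices 0 ≤ G d by
    simp only [hG, hδ, Finset.sum_sub_distrib] at this
    linarith
  by_contra! hlt
  have hlim : Filter.Tendsto G Filter.atTop (nhds 0) := by
    have := (ha.sub (hasSum_poissonWeight k)).tendsto_sum_nat
    rw [sub_self] at this
    exact this.comp (Filter.tendsto_add_atTop_nat 1)
  -- `G` tends to `0`, so a negative value at `d` must be made up by a later positive increment. By
  -- unimodality, `f` then stays above `C` on `[i, d]` once it reaches `C` at `i`.
  obtain ⟨l, hdl, hl⟩ : ∃ l, d < l ∧ C < f l := by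
    by_contra! hno
    have hle : ∀ N, d ≤ N → G N ≤ G d := by
      intro N hN
      induction N, hN using Nat.le_induction with
      | base => exact le_rfl
      | succ N hN ih =>
        have : G (N + 1) = G N + δ (N + 1) := Finset.sum_range_succ _ _
        linarith [hneg (N + 1) (hno _ (by omega))]
    have := le_of_tendsto hlim (Filter.eventually_atTop.2 ⟨d, hle⟩)
    linarith
  have hup : ∀ i j, i ≤ j → j ≤ d → C ≤ f i → C ≤ f j := fun i j hij hjd hi =>
    (le_min hi hl.le).trans (hflc.min_le hf0 hij (by omega : j ≤ l))
  have hzero : f 0 < C := by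
    by_contra! h
    exact absurd (Finset.sum_nonneg fun j hj =>
      hpos j (hup 0 j (by omega) (by have := Finset.mem_range.1 hj; omega) h)) (not_le.2 hlt)
  -- Either `f` has reached `C` by `m`, and `G` only increases from `m` to `d`, or all increments up
  -- to `m` are negative.
  have hGle : ∀ m, m ≤ d → G m ≤ 0 := by
    intro m hm
    by_cases h : ∃ i ≤ m, C ≤ f i
    · obtain ⟨i, him, hi⟩ := h
      refine le_trans ?_ hlt.le
      exact Finset.sum_le_sum_of_subset_of_nonneg (Finset.range_mono (by omega))
        fun j hj hj' => hpos j (hup i j (by simp at hj'; omega) (by simp at hj; omega) hi)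
    · push Not at h
      exact Finset.sum_nonpos fun j hj => hneg j (h j (by simp at hj; omega)).le
  -- The equality of the truncated means, contradicted by `G ≤ 0` on `[0, k - 1]` with `G 0 < 0`.
  have hsum : ∑ m ∈ Finset.range k, G m = 0 := by
    simp only [hG, sum_range_sum_range_succ, hδ, Finset.sum_sub_distrib, hmean, sub_self]
  have hlt0 : ∑ m ∈ Finset.range k, G m < 0 := by
    have := Finset.sum_lt_sum (s := Finset.range k) (f := G) (g := fun _ => 0)
      (fun m hm => hGle m (by simp at hm; omega))
      ⟨0, by simp; omega, by simpa [hG] using hneg' 0 hzero⟩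
    simpa using this
  linarith

/-- If an ultra log-concave distribution has the same expectation of `min (·, k)` as the Poisson
distribution with mean `k`, then its expectation of `acceptProb k` is at least as large. -/
theorem gam_le_sum_acceptProb {k : ℕ} (hk : 1 ≤ k) {n : ℕ} {a : ℕ → ℝ} (h0 : ∀ j, 0 ≤ a j)
    (hsupp : ∀ j, n < j → a j = 0) (hone : ∑ j ∈ Finset.range (n + 1), a j = 1)
    (hlc : ExchangeLogConcave fun j => (j.factorial : ℝ) * a j)
    (hut : ∑ j ∈ Finset.range (n + 1), UT k j * a j = gam k) :
    gam k ≤ ∑ j ∈ Finset.range (n + 1), acceptProb k j * a j := by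
  have hk0 : (0 : ℝ) < k := by exact_mod_cast hk
  have ha : HasSum a 1 := by
    rw [← hone]
    exact hasSum_sum_of_ne_finset_zero fun j hj => hsupp j (by simp at hj; omega)
  have hext : ∀ (g : ℕ → ℝ) N, n ≤ N → ∑ j ∈ Finset.range (N + 1), g j * a j =
      ∑ j ∈ Finset.range (n + 1), g j * a j := fun g N hN => by
    refine (Finset.sum_subset (Finset.range_mono (by omega)) fun j _ hj => ?_).symm
    rw [hsupp j (by simp at hj; omega), mul_zero]
  have hmean : ∑ j ∈ Finset.range k, ((k : ℝ) - j) * a j =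
      ∑ j ∈ Finset.range k, ((k : ℝ) - j) * poissonWeight k j := by
    have h1 : ∑ j ∈ Finset.range k, ((k : ℝ) - j) * a j =
        ∑ j ∈ Finset.range (n + k + 1), (k - k * UT k j) * a j := by
      have hv : ∀ j, j < k → (k : ℝ) - k * UT k j = k - j := fun j hj => by
        have : (j : ℝ) ≤ k := by exact_mod_cast hj.le
        rw [UT, min_eq_right ((div_le_one hk0).2 this), mul_div_cancel₀ _ hk0.ne']
      rw [← Finset.sum_subset (Finset.range_mono (by omega : k ≤ n + k + 1))]
      · exact Finset.sum_congr rfl fun j hj => by rw [hv j (Finset.mem_range.1 hj)]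
      · intro j _ hj
        have : (k : ℝ) ≤ j := by exact_mod_cast (by simpa using hj : k ≤ j)
        rw [UT, min_eq_left ((one_le_div hk0).2 this)]
        ring
    rw [sum_mul_poissonWeight, h1, hext _ _ (by omega)]
    simp only [sub_mul, Finset.sum_sub_distrib, mul_assoc, ← Finset.mul_sum, hone, hut, gam_eq]
    ring
  have hG : ∀ d, k ≤ d + 1 → 0 ≤ ∑ j ∈ Finset.range (d + 1), (a j - poissonWeight k j) := by
    intro d hd
    rw [Finset.sum_sub_distrib, sub_nonneg]
    exact sum_poissonWeight_le_of_exchangeLogConcave hk h0 ha hlc hmean hd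
  -- Summation by parts, started at `k - 1`: below `k` the factor is constantly `1`, so the signs of
  -- the earlier partial sums do not matter.
  have hpart : ∀ N, k ≤ N + 1 → acceptProb k N * ∑ j ∈ Finset.range (N + 1),
      (a j - poissonWeight k j) ≤
      ∑ j ∈ Finset.range (N + 1), acceptProb k j * (a j - poissonWeight k j) := by
    intro N hN
    have hN' : k - 1 ≤ N := by omega
    induction N, hN' using Nat.le_induction with
    | base =>
      rw [Finset.mul_sum]
      refine (Finset.sum_congr rfl fun j hj => ?_).le
      rw [acceptProb_of_lt (by omega), acceptProb_of_lt (by simp at hj; omega)]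
    | succ N hN' ih =>
      have h1 := ih (by omega)
      rw [Finset.sum_range_succ, Finset.sum_range_succ (fun j => acceptProb k j * _), mul_add]
      gcongr
      refine le_trans ?_ h1
      exact mul_le_mul_of_nonneg_right (acceptProb_antitone k (by omega)) (hG N (by omega))
  refine le_of_tendsto ((hasSum_acceptProb_mul_poissonWeight k).tendsto_sum_nat.comp
    (Filter.tendsto_add_atTop_nat 1)) (Filter.eventually_atTop.2 ⟨n + k, fun N hN => ?_⟩)
  rw [Function.comp_apply, ← hext _ N (by omega)]
  have h1 := hpart N (by omega)
  have h2 := mul_nonneg (acceptProb_nonneg k N) (hG N (by omega))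
  simp only [mul_sub (acceptProb k _), Finset.sum_sub_distrib] at h1 h2 ⊢
  linarith

/-! ### The law of the demand. -/

section DemandLaw

open ProbabilityTheory

variable {Ω : Type*} [MeasurableSpace Ω] {μ : Measure Ω}

theorem integral_comp_eq_sum [IsFiniteMeasure μ] {D : Ω → ℕ} (hD : Measurable D) {n : ℕ}
    (hn : ∀ ω, D ω ≤ n) (g : ℕ → ℝ) :
    ∫ ω, g (D ω) ∂μ = ∑ d ∈ Finset.range (n + 1), g d * μ.real {ω | D ω = d} := by
  have hms : ∀ d, MeasurableSet {ω | D ω = d} := fun d => hD (measurableSet_singleton d)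
  have h : ∀ ω, g (D ω) =
      ∑ d ∈ Finset.range (n + 1), {ω | D ω = d}.indicator (fun _ => g d) ω := by
    intro ω
    rw [Finset.sum_eq_single (D ω)]
    · simp
    · intro d _ hd
      exact Set.indicator_of_notMem (fun h => hd h.symm) _
    · intro h
      exact absurd (Finset.mem_range.2 (Nat.lt_succ_of_le (hn ω))) h
  simp_rw [h]
  rw [integral_finsetSum _ fun d _ => (integrable_const _).indicator (hms d)]
  refine Finset.sum_congr rfl fun d _ => ?_
  rw [integral_indicator_const _ (hms d), smul_eq_mul, mul_comm]

theorem measureReal_add_eq_succ [IsProbabilityMeasure μ] {S X : Ω → ℕ} (hS : Measurable S)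
    (hX : Measurable X) (hX1 : ∀ ω, X ω ≤ 1) (hind : IndepFun S X μ) (d : ℕ) :
    μ.real {ω | S ω + X ω = d + 1} = μ.real {ω | X ω = 0} * μ.real {ω | S ω = d + 1} +
      μ.real {ω | X ω = 1} * μ.real {ω | S ω = d} := by
  have hmul : ∀ a b, μ.real ({ω | S ω = a} ∩ {ω | X ω = b}) =
      μ.real {ω | X ω = b} * μ.real {ω | S ω = a} := fun a b => by
    have := hind.measure_inter_preimage_eq_mul {a} {b} (measurableSet_singleton a)
      (measurableSet_singleton b)
    rw [measureReal_def, measureReal_def, measureReal_def, ← ENNReal.toReal_mul, mul_comm]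
    exact congrArg _ this
  rw [← hmul, ← hmul, ← measureReal_union]
  · congr 1
    ext ω
    have := hX1 ω
    simp only [Set.mem_ofPred_eq, Set.mem_union, Set.mem_inter_iff]
    omega
  · rw [Set.disjoint_left]
    rintro ω ⟨_, h1⟩ ⟨_, h2⟩
    simp only [Set.mem_ofPred_eq] at h1 h2
    omega
  · exact (hS (measurableSet_singleton _)).inter (hX (measurableSet_singleton _))

theorem measureReal_add_eq_zero [IsProbabilityMeasure μ] {S X : Ω → ℕ} (hind : IndepFun S X μ) :
    μ.real {ω | S ω + X ω = 0} = μ.real {ω | X ω = 0} * μ.real {ω | S ω = 0} := by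
  have := hind.measure_inter_preimage_eq_mul {0} {0} (measurableSet_singleton 0)
    (measurableSet_singleton 0)
  rw [measureReal_def, measureReal_def, measureReal_def, ← ENNReal.toReal_mul, mul_comm (μ _),
    show {ω | S ω + X ω = 0} = S ⁻¹' {0} ∩ X ⁻¹' {0} by ext; simp]
  exact congrArg _ this

/-- The law of a sum of independent Bernoulli variables is ultra log-concave. -/
theorem exchangeLogConcave_sum_bernoulli [IsProbabilityMeasure μ] {ι : Type*} {X : ι → Ω → ℕ}
    (hX : ∀ i, Measurable (X i)) (hX1 : ∀ i ω, X i ω ≤ 1) (hind : iIndepFun X μ) (s : Finset ι) :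
    ExchangeLogConcave fun j => (j.factorial : ℝ) * μ.real {ω | ∑ i ∈ s, X i ω = j} := by
  classical
  induction s using Finset.induction_on with
  | empty =>
    intro i j _
    simp [show j + 2 = j + 1 + 1 from rfl]
  | insert i s hi ih =>
    have hmeas : Measurable fun ω => ∑ j ∈ s, X j ω := Finset.measurable_sum s fun j _ => hX j
    have hindep : IndepFun (fun ω => ∑ j ∈ s, X j ω) (X i) μ := by
      have := hind.indepFun_finsetSum_of_notMem hX hi
      rwa [show (∑ j ∈ s, X j) = fun ω => ∑ j ∈ s, X j ω by ext; simp] at this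
    have hset : ∀ d, {ω | ∑ j ∈ insert i s, X j ω = d} = {ω | ∑ j ∈ s, X j ω + X i ω = d} := by
      intro d
      ext ω
      rw [Set.mem_ofPred_eq, Finset.sum_insert hi, add_comm]
      rfl
    have hq : μ.real {ω | X i ω = 0} = 1 - μ.real {ω | X i ω = 1} := by
      have hms : MeasurableSet {ω | X i ω = 1} := hX i (measurableSet_singleton 1)
      rw [← probReal_compl_eq_one_sub hms]
      congr 1
      ext ω
      have := hX1 i ω
      simp only [Set.mem_ofPred_eq, Set.mem_compl_iff]
      omega
    refine ih.bernoulli_step (q := μ.real {ω | X i ω = 1}) (fun j => by positivity)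
      measureReal_nonneg measureReal_le_one ?_ ?_
    · simp only [hset, measureReal_add_eq_zero hindep, hq]
      ring
    · intro j
      simp only [hset, measureReal_add_eq_succ hmeas (hX i) (hX1 i) hindep, hq,
        Nat.factorial_succ]
      push_cast
      ring

/-- If the expected utilization of a sum of independent Bernoulli variables is `gam k`, then the
expectation of `acceptProb k` is at least `gam k`. -/
theorem gam_le_integral_acceptProb [IsProbabilityMeasure μ] {ι : Type*} [Fintype ι]
    {X : ι → Ω → ℕ} (hX : ∀ i, Measurable (X i)) (hX1 : ∀ i ω, X i ω ≤ 1) (hind : iIndepFun X μ)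
    {k : ℕ} (hk : 1 ≤ k) (hut : ∫ ω, UT k (∑ i, X i ω) ∂μ = gam k) :
    gam k ≤ ∫ ω, acceptProb k (∑ i, X i ω) ∂μ := by
  have hD : Measurable fun ω => ∑ i, X i ω := Finset.measurable_sum _ fun i _ => hX i
  have hle : ∀ ω, ∑ i, X i ω ≤ Fintype.card ι := fun ω => by
    simpa using Finset.sum_le_sum fun i (_ : i ∈ Finset.univ) => hX1 i ω
  rw [integral_comp_eq_sum hD hle] at hut ⊢
  refine gam_le_sum_acceptProb hk (fun j => measureReal_nonneg) ?_ ?_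
    (exchangeLogConcave_sum_bernoulli hX hX1 hind _) hut
  · intro j hj
    rw [show {ω | ∑ i, X i ω = j} = ∅ from Set.eq_empty_of_forall_notMem fun ω h => by
      have := hle ω
      simp only [Set.mem_ofPred_eq] at h
      omega]
    simp
  · have := integral_comp_eq_sum (μ := μ) hD hle fun _ => 1
    simpa using this.symm

end DemandLaw

/-! ### Random arrival order. -/

section Arrival

/-- The number of elements of `S` that are preceded by fewer than `k` others is
`min S.card k`. -/
theorem card_filter_rank_lt {α β : Type*} [LinearOrder β] (S : Finset α) {σ : α → β}
    (hσ : Function.Injective σ) (k : ℕ) :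
    (S.filter fun i => (S.filter fun j => σ j < σ i).card < k).card = min S.card k := by
  classical
  set r : α → ℕ := fun i => (S.filter fun j => σ j < σ i).card with hr
  have hlt : ∀ i ∈ S, ∀ j, σ i < σ j → r i < r j := fun i hi j hij => by
    refine Finset.card_lt_card (Finset.ssubset_iff_of_subset ?_ |>.2 ⟨i, ?_, ?_⟩)
    · exact fun l hl => by
        simp only [Finset.mem_filter] at hl ⊢
        exact ⟨hl.1, hl.2.trans hij⟩
    · simp [hi, hij]
    · simp
  have hinj : Set.InjOn r S := fun i hi j hj hij => by
    by_contra hne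
    rcases lt_or_gt_of_ne (hσ.ne hne) with h | h
    · exact (hlt i hi j h).ne hij
    · exact (hlt j hj i h).ne hij.symm
  -- The rank is injective on `S` with values below `S.card`, hence takes each such value once.
  have himg : S.image r = Finset.range S.card := by
    refine Finset.eq_of_subset_of_card_le ?_ ?_
    · intro m hm
      obtain ⟨i, hi, rfl⟩ := Finset.mem_image.1 hm
      refine Finset.mem_range.2 (Finset.card_lt_card (Finset.ssubset_iff_of_subset
        (Finset.filter_subset _ _) |>.2 ⟨i, hi, by simp⟩))
    · rw [Finset.card_image_of_injOn hinj, Finset.card_range]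
  rw [← Finset.card_image_of_injOn (hinj.mono (Finset.coe_subset.2 (Finset.filter_subset _ _))),
    show (S.filter fun i => r i < k).image r = (S.image r).filter (· < k) by
      rw [Finset.filter_image], himg]
  have : (Finset.range S.card).filter (· < k) = Finset.range (min S.card k) := by
    ext m; simp
  rw [this, Finset.card_range]

variable {n : ℕ}

theorem card_accepted (k : ℕ) (t : ℝ≥0) (ω : Outcome n) (σ : Equiv.Perm (Fin n)) :
    (accepted k t ω σ).card = min (demand t ω) k :=
  card_filter_rank_lt _ σ.injective k

/-- Swapping the positions of two eligible applicants preserves the eligible set, so one inherits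
the number of eligible predecessors of the other. Hence all eligible applicants are accepted in
equally many orders. -/
theorem mem_accepted_mul_swap {k : ℕ} {t : ℝ≥0} {ω : Outcome n} (σ : Equiv.Perm (Fin n))
    {i j : Fin n} (hi : i ∈ eligible t ω) (hj : j ∈ eligible t ω) :
    j ∈ accepted k t ω (σ * Equiv.swap i j) ↔ i ∈ accepted k t ω σ := by
  have hS : ∀ l, Equiv.swap i j l ∈ eligible t ω ↔ l ∈ eligible t ω := fun l => by
    by_cases h1 : l = i
    · subst h1; simp [hi, hj]
    by_cases h2 : l = j
    · subst h2; simp [hi, hj]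
    rw [Equiv.swap_apply_of_ne_of_ne h1 h2]
  have hcard : ((eligible t ω).filter fun l => (σ * Equiv.swap i j) l <
      (σ * Equiv.swap i j) j).card = ((eligible t ω).filter fun l => σ l < σ i).card := by
    refine Finset.card_equiv (Equiv.swap i j) fun l => ?_
    simp [hS]
  rw [accepted, accepted, Finset.mem_filter, Finset.mem_filter, hcard]
  simp [hi, hj]

/-- The number of arrival orders in which a given eligible applicant is accepted. -/
theorem card_filter_mem_accepted {k : ℕ} {t : ℝ≥0} {ω : Outcome n} {i : Fin n}
    (hi : i ∈ eligible t ω) :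
    ((Finset.univ.filter fun σ => i ∈ accepted k t ω σ).card : ℝ) =
      Fintype.card (Equiv.Perm (Fin n)) * acceptProb k ((eligible t ω).erase i).card := by
  have hcard : ((eligible t ω).erase i).card + 1 = demand t ω := Finset.card_erase_add_one hi
  have hconst : ∀ j ∈ eligible t ω, (Finset.univ.filter fun σ => j ∈ accepted k t ω σ).card =
      (Finset.univ.filter fun σ => i ∈ accepted k t ω σ).card := fun j hj =>
    (Finset.card_equiv (Equiv.mulRight (Equiv.swap i j)) fun σ => by
      simp [mem_accepted_mul_swap σ hi hj]).symm
  -- Double counting of pairs (order, accepted applicant); each order accepts `min D k` of them.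
  have hcount : ∑ j ∈ eligible t ω, (Finset.univ.filter fun σ => j ∈ accepted k t ω σ).card =
      ∑ σ : Equiv.Perm (Fin n), (accepted k t ω σ).card := by
    simp only [Finset.card_filter]
    rw [Finset.sum_comm]
    refine Finset.sum_congr rfl fun σ _ => ?_
    rw [← Finset.card_filter]
    congr 1
    ext j
    simp only [Finset.mem_filter, and_iff_right_iff_imp]
    exact fun h => (Finset.mem_filter.1 h).1
  rw [Finset.sum_congr rfl hconst, Finset.sum_const, smul_eq_mul,
    Finset.sum_congr rfl fun σ _ => card_accepted k t ω σ, Finset.sum_const, Finset.card_univ,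
    smul_eq_mul, ← demand.eq_1, ← hcard] at hcount
  have hcount' := congrArg (Nat.cast : ℕ → ℝ) hcount
  push_cast at hcount'
  set d : ℝ := (((eligible t ω).erase i).card : ℝ)
  have hd : 0 < d + 1 := by positivity
  have hacc : acceptProb k ((eligible t ω).erase i).card = min (d + 1) k / (d + 1) := by
    rw [← min_div_div_right hd.le, div_self hd.ne', acceptProb]
  rw [hacc, mul_div_assoc', eq_div_iff hd.ne', ← hcount', mul_comm]

end Arrival

/-! ### Performance against the dual value. -/

section Performance

open ProbabilityTheory

/-- The contribution of one applicant to the demand. -/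
noncomputable def demandOf (t : ℝ≥0) (x : ℝ≥0 × Bool) : ℕ :=
  if t < x.1 ∨ (x.1 = t ∧ x.2 = true) then 1 else 0

theorem demandOf_le_one (t : ℝ≥0) (x : ℝ≥0 × Bool) : demandOf t x ≤ 1 := by
  unfold demandOf; split_ifs <;> simp

theorem measurable_demandOf (t : ℝ≥0) : Measurable (demandOf t) := by
  refine Measurable.ite (MeasurableSet.union ?_ (MeasurableSet.inter ?_ ?_)) measurable_const
    measurable_const
  · exact measurable_fst measurableSet_Ioi
  · exact measurable_fst (measurableSet_singleton t)
  · exact measurable_snd (measurableSet_singleton true)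

theorem measurable_acceptProb (k : ℕ) : Measurable fun d : ℕ => ENNReal.ofReal (acceptProb k d) :=
  measurable_of_countable _

variable {n : ℕ}

theorem demand_eq_sum (t : ℝ≥0) (ω : Outcome n) : demand t ω = ∑ i, demandOf t (ω i) :=
  Finset.card_filter _ _

theorem card_erase_eligible (t : ℝ≥0) (ω : Outcome n) (i : Fin n) :
    ((eligible t ω).erase i).card = ∑ j ∈ Finset.univ.erase i, demandOf t (ω j) := by
  rw [eligible, ← Finset.filter_erase]
  exact Finset.card_filter _ _

theorem measurable_demand (t : ℝ≥0) : Measurable (demand t : Outcome n → ℕ) := by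
  simp_rw [funext (demand_eq_sum (n := n) t)]
  exact Finset.measurable_sum _ fun i _ => (measurable_demandOf t).comp (measurable_pi_apply i)

/-- The total value collected over all arrival orders: every accepted applicant contributes the
threshold, plus the excess of the value over the threshold. -/
theorem sum_perm_sum_accepted (k : ℕ) (t : ℝ≥0) (ω : Outcome n) :
    ∑ σ : Equiv.Perm (Fin n), ∑ i ∈ accepted k t ω σ, ((ω i).1 : ℝ≥0∞) =
      Fintype.card (Equiv.Perm (Fin n)) * (t * (min (demand t ω) k : ℕ) +
        ∑ i, (((ω i).1 - t : ℝ≥0) : ℝ≥0∞) *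
          ENNReal.ofReal (acceptProb k ((eligible t ω).erase i).card)) := by
  classical
  have hge : ∀ i ∈ eligible t ω, t ≤ (ω i).1 := fun i hi => by
    rcases (Finset.mem_filter.1 hi).2 with h | h
    · exact h.le
    · exact h.1.ge
  have hlt : ∀ i ∉ eligible t ω, (ω i).1 - t = 0 := fun i hi => by
    refine tsub_eq_zero_of_le (not_lt.1 fun h => hi ?_)
    simp [eligible, h]
  have hsub : ∀ σ, accepted k t ω σ ⊆ eligible t ω := fun σ => Finset.filter_subset _ _
  have h1 : ∀ σ : Equiv.Perm (Fin n), ∑ i ∈ accepted k t ω σ, ((ω i).1 : ℝ≥0∞) =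
      t * (min (demand t ω) k : ℕ) + ∑ i, (((ω i).1 - t : ℝ≥0) : ℝ≥0∞) *
        (if i ∈ accepted k t ω σ then 1 else 0) := fun σ => by
    simp only [mul_ite, mul_one, mul_zero, Finset.sum_ite_mem, Finset.univ_inter]
    rw [← card_accepted k t ω σ, mul_comm, ← nsmul_eq_mul, ← Finset.sum_const,
      ← Finset.sum_add_distrib]
    refine Finset.sum_congr rfl fun i hi => ?_
    rw [← ENNReal.coe_add, add_tsub_cancel_of_le (hge i (hsub σ hi))]
  simp_rw [h1]
  rw [Finset.sum_add_distrib, Finset.sum_const, Finset.card_univ, nsmul_eq_mul, mul_add,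
    Finset.sum_comm, Finset.mul_sum]
  congr 1
  refine Finset.sum_congr rfl fun i _ => ?_
  rw [← Finset.mul_sum, mul_left_comm]
  -- The acceptance frequency is known only for eligible applicants; for the others the truncated
  -- excess is zero.
  by_cases hi : i ∈ eligible t ω
  · congr 1
    rw [Finset.sum_boole, ← ENNReal.ofReal_natCast, card_filter_mem_accepted hi,
      ENNReal.ofReal_mul (by positivity), ENNReal.ofReal_natCast]
  · simp [hlt i hi]

variable (F : Fin n → Measure ℝ≥0) [∀ i, IsProbabilityMeasure (F i)] (p : unitInterval)

instance : IsProbabilityMeasure (law F p) := by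
  unfold law; infer_instance

theorem iIndepFun_law {β : Type*} [MeasurableSpace β] {f : ℝ≥0 × Bool → β} (hf : Measurable f) :
    iIndepFun (fun (i : Fin n) (ω : Outcome n) => f (ω i)) (law F p) :=
  iIndepFun_pi fun _ => hf.aemeasurable

theorem gam_le_integral_acceptProb_demand {k : ℕ} (hk : 1 ≤ k) {t : ℝ≥0}
    (hut : expectedUtilization k F t p = gam k) :
    gam k ≤ ∫ ω, acceptProb k (demand t ω) ∂(law F p) := by
  simp only [expectedUtilization, demand_eq_sum] at hut ⊢
  exact gam_le_integral_acceptProb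
    (fun i => (measurable_demandOf t).comp (measurable_pi_apply i))
    (fun i ω => demandOf_le_one _ _) (iIndepFun_law F p (measurable_demandOf t)) hk hut

theorem integrable_comp_demand (t : ℝ≥0) {g : ℕ → ℝ} (h0 : ∀ d, 0 ≤ g d) (h1 : ∀ d, g d ≤ 1) :
    Integrable (fun ω => g (demand t ω)) (law F p) :=
  Integrable.of_bound ((measurable_of_countable g).comp (measurable_demand t)).aestronglyMeasurable
    1 (Filter.Eventually.of_forall fun ω => by
      rw [Real.norm_of_nonneg (h0 _)]; exact h1 _)

/-- The excess of `i` is independent of the demand of the others, so the expectation factors.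
Replacing that demand by the larger total demand only lowers `acceptProb`. -/
theorem lintegral_excess_mul_acceptProb_ge {k : ℕ} (hk : 1 ≤ k) {t : ℝ≥0}
    (hut : expectedUtilization k F t p = gam k) (i : Fin n) :
    ENNReal.ofReal (gam k) * ∫⁻ v, ((v - t : ℝ≥0) : ℝ≥0∞) ∂(F i) ≤
      ∫⁻ ω, (((ω i).1 - t : ℝ≥0) : ℝ≥0∞) *
        ENNReal.ofReal (acceptProb k ((eligible t ω).erase i).card) ∂(law F p) := by
  have hex : Measurable fun v : ℝ≥0 => ((v - t : ℝ≥0) : ℝ≥0∞) := by fun_prop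
  have hoth : Measurable fun ω : Outcome n => ((eligible t ω).erase i).card := by
    simp_rw [card_erase_eligible]
    exact Finset.measurable_sum _ fun j _ => (measurable_demandOf t).comp (measurable_pi_apply j)
  have hind : IndepFun (fun ω : Outcome n => (((ω i).1 - t : ℝ≥0) : ℝ≥0∞))
      (fun ω => ENNReal.ofReal (acceptProb k ((eligible t ω).erase i).card)) (law F p) := by
    have h := (iIndepFun_law F p measurable_id).indepFun_finset {i} (Finset.univ.erase i)
      (by simp) fun j => measurable_pi_apply j
    have hφ : Measurable fun x : ({i} : Finset (Fin n)) → ℝ≥0 × Bool =>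
        (((x ⟨i, by simp⟩).1 - t : ℝ≥0) : ℝ≥0∞) :=
      hex.comp (measurable_fst.comp (measurable_pi_apply _))
    have hψ : Measurable fun x : ↥(Finset.univ.erase i) → ℝ≥0 × Bool =>
        ENNReal.ofReal (acceptProb k (∑ j, demandOf t (x j))) :=
      (measurable_acceptProb k).comp (Finset.measurable_sum _ fun j _ =>
        (measurable_demandOf t).comp (measurable_pi_apply j))
    have h2 := h.comp hφ hψ
    refine h2.congr (Filter.EventuallyEq.refl _ _) (Filter.Eventually.of_forall fun ω => ?_)
    dsimp only
    rw [card_erase_eligible, ← Finset.sum_coe_sort (Finset.univ.erase i)]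
    rfl
  have hprod := lintegral_mul_eq_lintegral_mul_lintegral_of_indepFun
    (hex.comp (measurable_fst.comp (measurable_pi_apply i)))
    ((measurable_acceptProb k).comp hoth) hind
  have hmarg : ∫⁻ ω : Outcome n, (((ω i).1 - t : ℝ≥0) : ℝ≥0∞) ∂(law F p) =
      ∫⁻ v, ((v - t : ℝ≥0) : ℝ≥0∞) ∂(F i) := by
    have h1 : (law F p).map (fun ω => ω i) =
        (F i).prod (bernoulliMeasure true false p) :=
      (measurePreserving_eval (fun i => (F i).prod (bernoulliMeasure true false p)) i).map_eq
    have h2 : (law F p).map (fun ω => (ω i).1) = F i := by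
      rw [show (fun ω : Outcome n => (ω i).1) = Prod.fst ∘ fun ω => ω i from rfl,
        ← Measure.map_map measurable_fst (measurable_pi_apply i), h1, ← Measure.fst,
        Measure.fst_prod]
    have hcoord : Measurable fun ω : Outcome n => (ω i).1 :=
      measurable_fst.comp (measurable_pi_apply i)
    conv_rhs => rw [← h2]
    rw [lintegral_map hex hcoord]
  refine le_trans ?_ hprod.ge
  rw [mul_comm]
  refine mul_le_mul' hmarg.ge ?_
  calc ENNReal.ofReal (gam k)
      ≤ ENNReal.ofReal (∫ ω, acceptProb k (demand t ω) ∂(law F p)) :=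
        ENNReal.ofReal_le_ofReal (gam_le_integral_acceptProb_demand F p hk hut)
    _ = ∫⁻ ω, ENNReal.ofReal (acceptProb k (demand t ω)) ∂(law F p) :=
        ofReal_integral_eq_lintegral_ofReal
          (integrable_comp_demand F p t (acceptProb_nonneg k) fun d => min_le_left _ _)
          (Filter.Eventually.of_forall fun ω => acceptProb_nonneg k _)
    _ ≤ _ := lintegral_mono fun ω => ENNReal.ofReal_le_ofReal
        (acceptProb_antitone k (Finset.card_le_card (Finset.erase_subset _ _)))

theorem lintegral_min_demand {k : ℕ} (hk : 1 ≤ k) {t : ℝ≥0}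
    (hut : expectedUtilization k F t p = gam k) :
    ∫⁻ ω, ((min (demand t ω) k : ℕ) : ℝ≥0∞) ∂(law F p) = k * ENNReal.ofReal (gam k) := by
  have hk0 : (0 : ℝ) < k := by exact_mod_cast hk
  have hUT0 : ∀ d, 0 ≤ UT k d := fun d => by unfold UT; positivity
  have h : ∀ d : ℕ, ((min d k : ℕ) : ℝ≥0∞) = k * ENNReal.ofReal (UT k d) := fun d => by
    rw [← ENNReal.ofReal_natCast k, ← ENNReal.ofReal_mul hk0.le, ← ENNReal.ofReal_natCast, UT,
      mul_min_of_nonneg _ _ hk0.le, mul_one, mul_div_cancel₀ _ hk0.ne', Nat.cast_min, min_comm]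
  simp_rw [h]
  rw [lintegral_const_mul' _ _ (ENNReal.natCast_ne_top k), ← hut, expectedUtilization,
    ofReal_integral_eq_lintegral_ofReal
      (integrable_comp_demand F p t hUT0 fun d => min_le_left _ _)
      (Filter.Eventually.of_forall fun ω => hUT0 _)]

/-- The performance is at least `gam k` times the dual value of the threshold. -/
theorem gam_mul_le_performance {k : ℕ} (hk : 1 ≤ k) {t : ℝ≥0}
    (hut : expectedUtilization k F t p = gam k) :
    ENNReal.ofReal (gam k) * (k * t + ∑ i, ∫⁻ v, ((v - t : ℝ≥0) : ℝ≥0∞) ∂(F i)) ≤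
      performance k F t p := by
  have hN0 : (Fintype.card (Equiv.Perm (Fin n)) : ℝ≥0∞) ≠ 0 := by
    exact_mod_cast Fintype.card_ne_zero
  have hpt : ∀ ω : Outcome n, (∑ σ : Equiv.Perm (Fin n), ∑ i ∈ accepted k t ω σ,
      ((ω i).1 : ℝ≥0∞)) / (Fintype.card (Equiv.Perm (Fin n)) : ℝ≥0∞) =
      t * (min (demand t ω) k : ℕ) + ∑ i, (((ω i).1 - t : ℝ≥0) : ℝ≥0∞) *
          ENNReal.ofReal (acceptProb k ((eligible t ω).erase i).card) := fun ω => by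
    rw [sum_perm_sum_accepted, mul_comm,
      ENNReal.mul_div_cancel_right hN0 (ENNReal.natCast_ne_top _)]
  have hmin : Measurable fun ω : Outcome n => (t : ℝ≥0∞) * ((min (demand t ω) k : ℕ) : ℝ≥0∞) :=
    (measurable_of_countable fun d : ℕ => (t : ℝ≥0∞) * ((min d k : ℕ) : ℝ≥0∞)).comp
      (measurable_demand t)
  have hterm : ∀ i : Fin n, Measurable fun ω : Outcome n => (((ω i).1 - t : ℝ≥0) : ℝ≥0∞) *
      ENNReal.ofReal (acceptProb k ((eligible t ω).erase i).card) := fun i => by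
    simp_rw [card_erase_eligible]
    refine Measurable.mul ?_ ((measurable_acceptProb k).comp (Finset.measurable_sum _ fun j _ =>
      (measurable_demandOf t).comp (measurable_pi_apply j)))
    fun_prop
  rw [performance, lintegral_congr hpt, lintegral_add_left hmin,
    lintegral_finsetSum _ fun i _ => hterm i, lintegral_const_mul' _ _ ENNReal.coe_ne_top,
    lintegral_min_demand F p hk hut, mul_add, Finset.mul_sum]
  refine add_le_add (le_of_eq (by ring)) (Finset.sum_le_sum fun i _ => ?_)
  exact lintegral_excess_mul_acceptProb_ge F p hk hut i

end Performance

/-! ### Quantile functions. -/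

section Quantile

variable {ν : Measure ℝ≥0} [IsProbabilityMeasure ν]

/-- The infimum is over a nonempty set because `z < 1`, and it is attained because distribution
functions are right-continuous. -/
theorem quantile_le_iff {z : ℝ} (hz : z ∈ Set.Ioo (0 : ℝ) 1) (x : ℝ≥0) :
    quantile ν z ≤ x ↔ z ≤ ν.real (Set.Iic x) := by
  have hmono : Monotone fun x : ℝ≥0 => ν.real (Set.Iic x) := fun a b h =>
    measureReal_mono (Set.Iic_subset_Iic.2 h)
  have hne : {x : ℝ≥0 | z ≤ ν.real (Set.Iic x)}.Nonempty := by
    have hlim := tendsto_measure_Iic_atTop ν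
    rw [measure_univ] at hlim
    have hlim' := (ENNReal.tendsto_toReal ENNReal.one_ne_top).comp hlim
    obtain ⟨x, hx⟩ := (hlim'.eventually (lt_mem_nhds hz.2)).exists
    exact ⟨x, le_of_lt hx⟩
  constructor
  · intro h
    refine le_trans ?_ (hmono h)
    have hrc : Filter.Tendsto (fun y => ν.real (Set.Iic y))
        (nhdsWithin (quantile ν z) (Set.Ioi (quantile ν z)))
        (nhds (ν.real (Set.Iic (quantile ν z)))) := by
      have h := tendsto_measure_biInter_gt (μ := ν) (s := fun y : ℝ≥0 => Set.Iic y)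
        (a := quantile ν z) (fun _ _ => measurableSet_Iic.nullMeasurableSet)
        (fun _ _ _ hij => Set.Iic_subset_Iic.2 hij)
        ⟨quantile ν z + 1, lt_add_one _, measure_ne_top _ _⟩
      rw [show ⋂ r, ⋂ (_ : r > quantile ν z), Set.Iic r = Set.Iic (quantile ν z) by
        ext y
        simpa using ⟨fun h => le_of_forall_gt_imp_ge_of_dense h,
          fun h r hr => h.trans (le_of_lt hr)⟩] at h
      exact (ENNReal.tendsto_toReal (measure_ne_top _ _)).comp h
    refine ge_of_tendsto hrc ?_
    filter_upwards [self_mem_nhdsWithin] with y hy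
    obtain ⟨w, hw, hwy⟩ := exists_lt_of_csInf_lt hne hy
    exact le_trans hw (hmono hwy.le)
  · exact fun h => csInf_le (OrderBot.bddBelow _) h

theorem quantile_monotoneOn : MonotoneOn (quantile ν) (Set.Ioo 0 1) := fun _ ha _ hb hab =>
  (quantile_le_iff ha _).2 (hab.trans ((quantile_le_iff hb _).1 le_rfl))

theorem aemeasurable_quantile :
    AEMeasurable (quantile ν) (volume.restrict (Set.Ioo (0 : ℝ) 1)) :=
  aemeasurable_restrict_of_monotoneOn measurableSet_Ioo quantile_monotoneOn

/-- The quantile function transports the uniform distribution to `ν`. -/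
theorem map_quantile : (volume.restrict (Set.Ioo (0 : ℝ) 1)).map (quantile ν) = ν := by
  have : IsFiniteMeasure ((volume.restrict (Set.Ioo (0 : ℝ) 1)).map (quantile ν)) := by
    infer_instance
  refine Measure.ext_of_Iic _ _ fun x => ?_
  rw [Measure.map_apply_of_aemeasurable aemeasurable_quantile measurableSet_Iic,
    Measure.restrict_apply' measurableSet_Ioo]
  have hset : (quantile ν ⁻¹' Set.Iic x ∩ Set.Ioo 0 1 : Set ℝ) =ᵐ[volume]
      Set.Ioc 0 (ν.real (Set.Iic x)) := by
    have h1 : quantile ν ⁻¹' Set.Iic x ∩ Set.Ioo 0 1 =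
        Set.Ioc 0 (ν.real (Set.Iic x)) ∩ Set.Iio 1 := by
      ext z
      simp only [Set.mem_inter_iff, Set.mem_preimage, Set.mem_Iic, Set.mem_Ioo, Set.mem_Ioc,
        Set.mem_Iio]
      constructor
      · rintro ⟨h, hz⟩
        exact ⟨⟨hz.1, (quantile_le_iff hz x).1 h⟩, hz.2⟩
      · rintro ⟨⟨h0, h⟩, h1⟩
        exact ⟨(quantile_le_iff ⟨h0, h1⟩ x).2 h, h0, h1⟩
    have h2 : Set.Ioc 0 (ν.real (Set.Iic x)) =
        Set.Ioc 0 (ν.real (Set.Iic x)) ∩ Set.Iic 1 := by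
      refine (Set.inter_eq_left.2 fun z hz => ?_).symm
      exact hz.2.trans measureReal_le_one
    rw [h1]
    conv_rhs => rw [h2]
    exact (Filter.EventuallyEq.refl _ _).inter Iio_ae_eq_Iic
  rw [measure_congr hset, Real.volume_Ioc, sub_zero, ofReal_measureReal]

/-- The top `x` quantiles contribute at most `t x` plus the expected excess over `t`. -/
theorem lintegral_quantile_le (t : ℝ≥0) {x : ℝ} (h1 : x ≤ 1) :
    ∫⁻ z in Set.Ioo (1 - x) 1, (quantile ν z : ℝ≥0∞) ≤
      t * ENNReal.ofReal x + ∫⁻ v, ((v - t : ℝ≥0) : ℝ≥0∞) ∂ν := by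
  have hle : ∀ v : ℝ≥0, (v : ℝ≥0∞) ≤ t + ((v - t : ℝ≥0) : ℝ≥0∞) := fun v => by
    exact_mod_cast le_add_tsub
  calc ∫⁻ z in Set.Ioo (1 - x) 1, (quantile ν z : ℝ≥0∞)
      ≤ ∫⁻ z in Set.Ioo (1 - x) 1, (t + ((quantile ν z - t : ℝ≥0) : ℝ≥0∞)) :=
        lintegral_mono fun z => hle _
    _ = t * ENNReal.ofReal x +
        ∫⁻ z in Set.Ioo (1 - x) 1, ((quantile ν z - t : ℝ≥0) : ℝ≥0∞) := by
        rw [lintegral_add_left measurable_const, setLIntegral_const, Real.volume_Ioo,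
          sub_sub_cancel]
    _ ≤ t * ENNReal.ofReal x +
        ∫⁻ z in Set.Ioo 0 1, ((quantile ν z - t : ℝ≥0) : ℝ≥0∞) := by
        gcongr
        linarith
    _ = _ := by
        congr 1
        have hm : Measurable fun v : ℝ≥0 => ((v - t : ℝ≥0) : ℝ≥0∞) := by fun_prop
        conv_rhs => rw [← map_quantile (ν := ν)]
        rw [lintegral_map' hm.aemeasurable aemeasurable_quantile]

/-- The expected value on an event of probability `x` is at most the contribution of the top `x`
quantiles. -/
theorem setLIntegral_le_lintegral_quantile {Ω : Type*} [MeasurableSpace Ω] {μ : Measure Ω}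
    [IsProbabilityMeasure μ] {V : Ω → ℝ≥0} (hV : Measurable V) (hmap : μ.map V = ν) (A : Set Ω) :
    ∫⁻ ω in A, (V ω : ℝ≥0∞) ∂μ ≤
      ∫⁻ z in Set.Ioo (1 - μ.real A) 1, (quantile ν z : ℝ≥0∞) := by
  have hx1 : μ.real A ≤ 1 := measureReal_le_one
  have hsub : Set.Ioo (1 - μ.real A) 1 ⊆ Set.Ioo (0 : ℝ) 1 :=
    Set.Ioo_subset_Ioo_left (by linarith)
  have hQ : AEMeasurable (quantile ν) (volume.restrict (Set.Ioo (1 - μ.real A) 1)) :=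
    aemeasurable_quantile.mono_measure (Measure.restrict_mono hsub le_rfl)
  -- Layer-cake formula on both sides. The tail `μ(A ∩ {V > s})` is at most `min(μ A, ν(s, ∞))`,
  -- which is exactly the tail of the top quantiles.
  have e1 := lintegral_eq_lintegral_meas_lt (μ.restrict A) (f := fun ω => (V ω : ℝ))
    (Filter.Eventually.of_forall fun ω => NNReal.coe_nonneg _)
    (hV.coe_nnreal_real).aemeasurable
  have e2 := lintegral_eq_lintegral_meas_lt (volume.restrict (Set.Ioo (1 - μ.real A) 1))
    (f := fun z => (quantile ν z : ℝ))
    (Filter.Eventually.of_forall fun ω => NNReal.coe_nonneg _) hQ.coe_nnreal_real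
  simp only [ENNReal.ofReal_coe_nnreal] at e1 e2
  rw [e1, e2]
  refine setLIntegral_mono' measurableSet_Ioi fun s hs => ?_
  lift s to ℝ≥0 using le_of_lt hs
  simp only [NNReal.coe_lt_coe]
  have hset : {z | s < quantile ν z} ∩ Set.Ioo (1 - μ.real A) 1 =
      Set.Ioo (max (1 - μ.real A) (ν.real (Set.Iic s))) 1 := by
    ext z
    simp only [Set.mem_inter_iff, Set.mem_ofPred_eq, Set.mem_Ioo, max_lt_iff]
    constructor
    · rintro ⟨h, hz⟩
      refine ⟨⟨hz.1, ?_⟩, hz.2⟩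
      rwa [← not_le, quantile_le_iff (hsub hz), not_le] at h
    · rintro ⟨⟨h0, h⟩, h1⟩
      refine ⟨?_, h0, h1⟩
      rwa [← not_le, quantile_le_iff (hsub ⟨h0, h1⟩), not_le]
  rw [Measure.restrict_apply' measurableSet_Ioo, hset, Real.volume_Ioo,
    Measure.restrict_apply (measurableSet_lt measurable_const hV)]
  refine ENNReal.le_ofReal_iff_toReal_le (measure_ne_top _ _) (by
    have : ν.real (Set.Iic s) ≤ 1 := measureReal_le_one
    have h0 : 0 ≤ μ.real A := measureReal_nonneg
    rw [sub_nonneg]; exact max_le (by linarith) this) |>.2 ?_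
  rw [le_sub_comm, max_le_iff]
  change _ ≤ 1 - μ.real _ ∧ _ ≤ 1 - μ.real _
  constructor
  · exact sub_le_sub_left (measureReal_mono Set.inter_subset_right) _
  · have h1 : ν.real (Set.Iic s) = 1 - μ.real {ω | s < V ω} := by
      rw [← hmap, map_measureReal_apply hV measurableSet_Iic,
        ← probReal_compl_eq_one_sub (measurableSet_lt measurable_const hV)]
      congr 1
      ext ω
      simp
    rw [h1]
    exact sub_le_sub_left (measureReal_mono Set.inter_subset_left) _

end Quantile

/-! ### The LP relaxation. -/

section ExAnte

variable {n : ℕ}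

/-- Weak duality for the LP relaxation. -/
theorem exAnteValue_le (k : ℕ) (F : Fin n → Measure ℝ≥0) [∀ i, IsProbabilityMeasure (F i)]
    (t : ℝ≥0) :
    exAnteValue k F ≤ k * t + ∑ i, ∫⁻ v, ((v - t : ℝ≥0) : ℝ≥0∞) ∂(F i) := by
  refine iSup₂_le fun x hx => ?_
  refine (Finset.sum_le_sum fun i _ => lintegral_quantile_le t (hx.1 i).2).trans ?_
  rw [Finset.sum_add_distrib, ← Finset.mul_sum, ← ENNReal.ofReal_sum_of_nonneg
    fun i _ => (hx.1 i).1, mul_comm]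
  gcongr
  rw [← ENNReal.ofReal_natCast]
  exact ENNReal.ofReal_le_ofReal hx.2

/-- Makes membership of an applicant in the prophet's set an event. Measurability of `c` is stated
through level sets, since `α` carries no σ-algebra. -/
theorem exists_measurable_argmax {α Ω : Type*} [MeasurableSpace Ω] (f : α → Ω → ℝ≥0)
    (hf : ∀ a, Measurable (f a)) {s : Finset α} (hs : s.Nonempty) :
    ∃ c : Ω → α, (∀ a, MeasurableSet {ω | c ω = a}) ∧ (∀ ω, c ω ∈ s) ∧
      Measurable (fun ω => f (c ω) ω) ∧ ∀ ω, ∀ a ∈ s, f a ω ≤ f (c ω) ω := by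
  classical
  induction hs using Finset.Nonempty.cons_induction with
  | singleton a =>
    exact ⟨fun _ => a, fun b => MeasurableSet.const _, by simp, hf a, by simp⟩
  | cons a s ha hs ih =>
    obtain ⟨c, hc, hcs, hcm, hmax⟩ := ih
    have hP : MeasurableSet {ω | f (c ω) ω ≤ f a ω} := measurableSet_le hcm (hf a)
    refine ⟨fun ω => if f (c ω) ω ≤ f a ω then a else c ω, fun b => ?_, fun ω => ?_, ?_,
      fun ω b hb => ?_⟩
    · have : {ω | (if f (c ω) ω ≤ f a ω then a else c ω) = b} =
          ({ω | f (c ω) ω ≤ f a ω} ∩ {_ω | a = b}) ∪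
            ({ω | f (c ω) ω ≤ f a ω}ᶜ ∩ {ω | c ω = b}) := by
        ext ω
        by_cases h : f (c ω) ω ≤ f a ω <;> simp [h]
      rw [this]
      exact (hP.inter (MeasurableSet.const _)).union (hP.compl.inter (hc b))
    · dsimp only
      split_ifs
      · simp
      · exact Finset.mem_cons_of_mem (hcs ω)
    · have : (fun ω => f (if f (c ω) ω ≤ f a ω then a else c ω) ω) =
          fun ω => if f (c ω) ω ≤ f a ω then f a ω else f (c ω) ω := by
        funext ω
        split_ifs <;> rfl
      rw [this]
      exact Measurable.ite hP (hf a) hcm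
    · dsimp only
      rcases Finset.mem_cons.1 hb with rfl | hb
      · split_ifs with h
        · exact le_rfl
        · exact (not_le.1 h).le
      · split_ifs with h
        · exact (hmax ω b hb).trans h
        · exact hmax ω b hb

/-- The prophet's value is at most the LP relaxation. -/
theorem prophetValue_le_exAnteValue (k : ℕ) (F : Fin n → Measure ℝ≥0)
    [∀ i, IsProbabilityMeasure (F i)] : prophetValue k F ≤ exAnteValue k F := by
  classical
  obtain ⟨c, hc, hcs, -, hmax⟩ := exists_measurable_argmax
    (fun (S : Finset (Fin n)) (v : Fin n → ℝ≥0) => ∑ i ∈ S, v i) (fun S => by fun_prop)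
    (s := Finset.univ.filter fun S : Finset (Fin n) => S.card ≤ k) ⟨∅, by simp⟩
  set μ := Measure.pi F with hμ
  -- The probabilities of these events are the LP solution: they sum to the expected size of the
  -- chosen set, which is at most `k`.
  set A : Fin n → Set (Fin n → ℝ≥0) := fun i => {v | i ∈ c v} with hA
  have hAm : ∀ i, MeasurableSet (A i) := fun i => by
    have : A i = ⋃ S ∈ Finset.univ.filter (fun S : Finset (Fin n) => i ∈ S), {v | c v = S} := by
      ext v; simp [hA]
    rw [this]
    exact Finset.measurableSet_biUnion _ fun S _ => hc S
  have hfeas : ∑ i, μ.real (A i) ≤ k := by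
    have h1 : ∑ i, μ.real (A i) = ∫ v, ((c v).card : ℝ) ∂μ := by
      have : ∀ v, ((c v).card : ℝ) = ∑ i, (A i).indicator (fun _ => (1 : ℝ)) v := fun v => by
        simp [Set.indicator_apply, hA]
      simp_rw [this]
      rw [integral_finsetSum _ fun i _ => (integrable_const _).indicator (hAm i)]
      exact Finset.sum_congr rfl fun i _ => by simp [integral_indicator_const _ (hAm i)]
    rw [h1]
    have h2 : ∀ v, ((c v).card : ℝ) ≤ k := fun v => by
      exact_mod_cast (Finset.mem_filter.1 (hcs v)).2
    calc ∫ v, ((c v).card : ℝ) ∂μ ≤ ∫ _, (k : ℝ) ∂μ :=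
          integral_mono_of_nonneg (Filter.Eventually.of_forall fun v => by positivity)
            (integrable_const _) (Filter.Eventually.of_forall h2)
      _ = k := by simp
  have htop : ∀ v, (topSum k v : ℝ≥0∞) ≤
      ∑ i, (A i).indicator (fun v : Fin n → ℝ≥0 => (v i : ℝ≥0∞)) v := fun v => by
    have h1 : topSum k v ≤ ∑ i ∈ c v, v i := Finset.sup_le fun S hS => hmax v S hS
    refine (ENNReal.coe_le_coe.2 h1).trans (le_of_eq ?_)
    rw [ENNReal.ofNNReal_finsetSum]
    simp [Set.indicator_apply, hA, Finset.sum_ite_mem]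
  calc prophetValue k F
      ≤ ∫⁻ v, ∑ i, (A i).indicator (fun v : Fin n → ℝ≥0 => (v i : ℝ≥0∞)) v ∂μ :=
        lintegral_mono htop
    _ = ∑ i, ∫⁻ v in A i, (v i : ℝ≥0∞) ∂μ := by
        rw [lintegral_finsetSum _ fun i _ =>
          ((measurable_pi_apply i).coe_nnreal_ennreal).indicator (hAm i)]
        exact Finset.sum_congr rfl fun i _ => lintegral_indicator (hAm i) _
    _ ≤ ∑ i, ∫⁻ z in Set.Ioo (1 - μ.real (A i)) 1, (quantile (F i) z : ℝ≥0∞) :=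
        Finset.sum_le_sum fun i _ => setLIntegral_le_lintegral_quantile (measurable_pi_apply i)
          (measurePreserving_eval F i).map_eq _
    _ ≤ exAnteValue k F := by
        refine le_iSup₂_of_le (fun i => μ.real (A i))
          ⟨fun i => ⟨measureReal_nonneg, measureReal_le_one⟩, hfeas⟩ le_rfl

end ExAnte

end ProphetSecretary

theorem theorem2 (k n : ℕ) (hk : 1 ≤ k) (F : Fin n → Measure ℝ≥0)
    (hF : ∀ i, IsProbabilityMeasure (F i)) (t : ℝ≥0) (p : unitInterval)
    (hut : ProphetSecretary.expectedUtilization k F t p = ProphetSecretary.gam k) :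
    ENNReal.ofReal (ProphetSecretary.gam k) * ProphetSecretary.prophetValue k F
        ≤ ProphetSecretary.performance k F t p ∧
      ENNReal.ofReal (ProphetSecretary.gam k) * ProphetSecretary.exAnteValue k F
        ≤ ProphetSecretary.performance k F t p ∧
      ProphetSecretary.prophetValue k F ≤ ProphetSecretary.exAnteValue k F := by
  have hprophet := ProphetSecretary.prophetValue_le_exAnteValue k F
  have hexAnte : ENNReal.ofReal (ProphetSecretary.gam k) * ProphetSecretary.exAnteValue k F
      ≤ ProphetSecretary.performance k F t p :=
    (mul_le_mul_right (ProphetSecretary.exAnteValue_le k F t) _).trans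
      (ProphetSecretary.gam_mul_le_performance F p hk hut)
  exact ⟨(mul_le_mul_right hprophet _).trans hexAnte, hexAnte, hprophet⟩
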